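/- Let $\mathbb N_0=\{0,1,2,\dots\}$. For $n\ge 1$ and $1\le i\le n$ let $\pi_i$ be the orthogonal projection of $\mathbb R^n$ onto the coordinate hyperplane $\{x_i=0\}$, and for a finite set $A\subset\mathbb R^n$ put $\sigma_n(A)=\sum_{i=1}^n|\pi_i(A)|$. The cube order on $\mathbb N_0^n$ is the linear order in which $(x_1,\dots,x_n)$ precedes $(y_1,\dots,y_n)$ if there are $l_0\in\mathbb N_0$ and $j\in[1,n]$ such that $\{i\in[1,n]: x_i=l\}=\{i\in[1,n]: y_i=l\}$ for every $l>l_0$, $\{i\in[j+1,n]: x_i=l_0\}=\{i\in[j+1,n]: y_i=l_0\}$, and $x_j<y_j=l_0$. For an integer $m\ge 0$ let $\mathcal I_n(m)$ be the initial segment of $\mathbb N_0^n$ of length $m$ in this order, and put $\sigma_n(m)=\sigma_n(\mathcal I_n(m))$; put also $\sigma_0(m)=0$ for all $m\ge0$. Then for any integers $n,s\ge 1$ and $m_1,\dots,m_s\ge 0$, $$\sigma_n(m_1+\dots+m_s)\le \sigma_{n-1}(m_1)+\dots+\sigma_{n-1}(m_s)+\max\{m_1,\dots,m_s\}.\qquad(1)$$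 Moreover, the assertion that (1) holds for all integers $n,s\ge1$ and $m_1,\dots,m_s\ge0$ is equivalent to the assertion that $\sigma_n(A)\ge\sigma_n(|A|)$ for every integer $n\ge1$ and every finite set $A\subset\mathbb R^n$. -/

import Mathlib

/-- The cube order on `ℕ^n`: `x` strictly precedes `y` if for some level `l₀` and some index `j`,
the sets `{i | x i = l}` and `{i | y i = l}` agree for all `l > l₀`, the sets
`{i > j | x i = l₀}` and `{i > j | y i = l₀}` agree, and `x j < y j = l₀`. -/
def CubePrec {n : ℕ} (x y : Fin n → ℕ) : Prop :=
  ∃ (l₀ : ℕ) (j : Fin n),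
    (∀ l, l₀ < l → {i | x i = l} = {i | y i = l}) ∧
    {i | j < i ∧ x i = l₀} = {i | j < i ∧ y i = l₀} ∧
    x j < y j ∧ y j = l₀

/-- The initial segment of length `m` of `ℕ^n` with respect to the cube order: the points that
have fewer than `m` predecessors. (For `n = 0` the whole space has only one point.) -/
def initialSegment (n m : ℕ) : Set (Fin n → ℕ) :=
  {x | {y | CubePrec y x}.encard < (m : ℕ∞)}

/-- The orthogonal projection onto the coordinate hyperplane `x i = 0`. -/
def coordProj {n : ℕ} {α : Type*} [Zero α] (i : Fin n) (x : Fin n → α) : Fin n → α :=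
  Function.update x i 0

/-- The sum of the sizes of the projections of a (finite) set onto the coordinate hyperplanes. -/
noncomputable def projSum {n : ℕ} {α : Type*} [Zero α] (A : Set (Fin n → α)) : ℕ :=
  ∑ i : Fin n, (coordProj i '' A).ncard

/-- The projection sum `σ_n(m)` of the initial segment of length `m` in `ℕ^n`. -/
noncomputable def sigma (n m : ℕ) : ℕ :=
  projSum (initialSegment n m)

/-!
Both assertions, the inequality for sums and the lower bound for projections of finite sets, are
proved unconditionally, so their equivalence follows. The second is the main point, and the first is
obtained from it by stacking nested initial segments of `ℕ^(n-1)` as slices of a set in `ℕ^n`.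

Write `B` for a box in `ℕ^(n+1)` with `j` sides of length `k + 1` and `n + 1 - j` sides of length `k`. In the
cube order the boxes are initial segments, and after `B` the next points fill a new face of `B`, in
the cube order of `ℕ^n`. Hence `sigma (n + 1) (|B| + r) = sigma (n + 1) |B| + sigma n r` for `r` up
to the size of that face (`sigma_boxSize_add`), and every `m ≥ 1` has the form `|B| + r`. This
recursion, with the values of `sigma` at `0` and `1`, is all that the projection inequality needs
to know about the cube order.

For a finite set `A` with `k ^ (n + 1) < |A| ≤ (k + 1) ^ (n + 1)`, some direction has at least
`k + 1` nonempty slices, as `A` would otherwise lie in a product of sets with at most `k` elements.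
Remove the smallest slice in that direction, with `b ≤ |A| / (k + 1)` points. The projections along
the other directions split into those of the slice and those of the rest, so by induction the
projection sum of `A` is at least `sigma (n + 1) (|A| - b) + sigma n b`. It remains to show that
this is at least `sigma (n + 1) |A|`, which is the purely numerical property `SigmaSlice`.

`SigmaSlice` is proved by induction on the dimension, together with subadditivity of `sigma n`
(`SigmaSubadditive`) and the fact that the last window of a box contributes least
(`SigmaFinalWindow`).
-/

/-! ### The cube order -/

theorem CubePrec.irrefl {n : ℕ} (x : Fin n → ℕ) : ¬ CubePrec x x := by
  rintro ⟨_, j, _, _, h, _⟩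
  exact lt_irrefl _ h

theorem CubePrec.total {n : ℕ} {x y : Fin n → ℕ} (h : x ≠ y) : CubePrec x y ∨ CubePrec y x := by
  obtain ⟨i₀, hi₀⟩ := Function.ne_iff.mp h
  -- The deciding index: the largest coordinate value on which the points differ, ties broken
  -- in favour of the larger index.
  obtain ⟨j, hj, hmax⟩ := Finset.exists_max_image (Finset.univ.filter fun i => x i ≠ y i)
    (fun i => (toLex (max (x i) (y i), i) : ℕ ×ₗ Fin n)) ⟨i₀, by simpa using hi₀⟩
  have hj' : x j ≠ y j := by simpa using hj
  have key : ∀ i, x i ≠ y i → max (x i) (y i) < max (x j) (y j) ∨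
      (max (x i) (y i) = max (x j) (y j) ∧ i ≤ j) := by
    intro i hi
    have := hmax i (by simpa using hi)
    simpa [Prod.Lex.toLex_le_toLex] using this
  rcases lt_or_gt_of_ne hj' with hlt | hlt
  · refine Or.inl ⟨y j, j, ?_, ?_, hlt, rfl⟩ <;> intros <;> ext i <;> have := key i <;>
      simp only [Set.mem_ofPred_eq] <;> grind
  · refine Or.inr ⟨x j, j, ?_, ?_, hlt, rfl⟩ <;> intros <;> ext i <;> have := key i <;>
      simp only [Set.mem_ofPred_eq] <;> grind

/-- A set of points is lower if it contains every predecessor, in the cube order, of each of its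
points. -/
def IsCubeLower {n : ℕ} (D : Finset (Fin n → ℕ)) : Prop :=
  ∀ x y, CubePrec x y → y ∈ D → x ∈ D

/-- Irreflexivity and totality of the order suffice here; transitivity is not used. -/
theorem initialSegment_card {n : ℕ} {D : Finset (Fin n → ℕ)} (hD : IsCubeLower D) :
    initialSegment n D.card = D := by
  ext x
  simp only [initialSegment, Set.mem_ofPred_eq, Finset.mem_coe]
  constructor
  · intro h
    by_contra hx
    refine absurd h (not_lt.mpr ?_)
    rw [← Set.encard_coe_eq_coe_finsetCard]
    refine Set.encard_le_encard fun y hy => ?_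
    have hne : y ≠ x := fun e => hx (e ▸ hy)
    exact (CubePrec.total hne).resolve_right fun h' => hx (hD _ _ h' hy)
  · intro hx
    have hsub : {y | CubePrec y x} ⊆ ((D.erase x : Finset _) : Set (Fin n → ℕ)) := by
      intro y hy
      have hne : y ≠ x := fun e => CubePrec.irrefl x (by rw [e] at hy; exact hy)
      simpa [hne] using hD _ _ hy hx
    refine (Set.encard_le_encard hsub).trans_lt ?_
    rw [Set.encard_coe_eq_coe_finsetCard]
    exact_mod_cast Finset.card_erase_lt_of_mem hx

/-! ### Boxes and the recursion for the projection sums -/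

/-- The size of the box with `j` sides of length `k + 1` and `n - j` sides of length `k`. -/
def boxSize (n k j : ℕ) : ℕ := (k + 1) ^ j * k ^ (n - j)

/-- The box in `ℕ^n` whose first `j` sides have length `k + 1` and whose other sides have
length `k`. These are the boxes among the initial segments. -/
def box (n k j : ℕ) : Finset (Fin n → ℕ) :=
  Fintype.piFinset fun i => Finset.range (if (i : ℕ) < j then k + 1 else k)

theorem mem_box {n k j : ℕ} {x : Fin n → ℕ} :
    x ∈ box n k j ↔ ∀ i : Fin n, x i < if (i : ℕ) < j then k + 1 else k := by
  simp [box]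

theorem card_box {n k j : ℕ} (hj : j ≤ n) : (box n k j).card = boxSize n k j := by
  have h1 : (Finset.range n).filter (fun i => i < j) = Finset.range j := by
    ext i; simp; omega
  have h2 : (Finset.range n).filter (fun i => ¬ i < j) = Finset.Ico j n := by
    ext i; simp; omega
  simp only [box, Fintype.card_piFinset, Finset.card_range, boxSize]
  rw [Fin.prod_univ_eq_prod_range (fun i => if i < j then k + 1 else k) n, Finset.prod_ite, h1, h2]
  simp

theorem isCubeLower_box (n k j : ℕ) : IsCubeLower (box n k j) := by
  rintro x y ⟨l, p, h1, h2, h3, h4⟩ hy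
  rw [mem_box] at hy ⊢
  intro i
  by_contra hi
  have e1 : l < x i → y i = x i := fun h => by
    exact (Set.ext_iff.mp (h1 _ h) i).mp rfl
  have e2 : p < i → x i = l → y i = l := fun h h' => by
    exact ((Set.ext_iff.mp h2 i).mp ⟨h, h'⟩).2
  have := hy i
  have := hy p
  have e3 : (p : ℕ) < i → p < i := fun h => h
  grind

/-- The box `box (n + 1) k j` together with a copy of `E`, placed on the face on which coordinate
`j` has the new value `k`. -/
def boxExtend (n k : ℕ) (j : Fin (n + 1)) (E : Finset (Fin n → ℕ)) : Finset (Fin (n + 1) → ℕ) :=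
  box (n + 1) k j ∪ E.image (j.insertNth (α := fun _ => ℕ) k)

theorem mem_boxExtend {n k : ℕ} {j : Fin (n + 1)} {E : Finset (Fin n → ℕ)}
    {x : Fin (n + 1) → ℕ} :
    x ∈ boxExtend n k j E ↔ x ∈ box (n + 1) k j ∨ (x j = k ∧ j.removeNth x ∈ E) := by
  simp only [boxExtend, Finset.mem_union, Finset.mem_image]
  refine or_congr_right ⟨?_, fun ⟨h, h'⟩ => ⟨_, h', ?_⟩⟩
  · rintro ⟨z, hz, rfl⟩
    simpa using hz
  · rw [← h]; exact Fin.insertNth_self_removeNth j x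

theorem card_boxExtend {n k : ℕ} {j : Fin (n + 1)} {E : Finset (Fin n → ℕ)} :
    (boxExtend n k j E).card = boxSize (n + 1) k j + E.card := by
  have hinj : Function.Injective (j.insertNth (α := fun _ => ℕ) k) :=
    Fin.insertNth_right_injective (α := fun _ => ℕ) (p := j) k
  rw [boxExtend, Finset.card_union_of_disjoint, card_box j.is_lt.le,
    Finset.card_image_of_injective _ hinj]
  refine Finset.disjoint_left.mpr fun x hx hx' => ?_
  obtain ⟨z, -, rfl⟩ := Finset.mem_image.mp hx'
  simpa using mem_box.mp hx j

theorem CubePrec.removeNth {n : ℕ} {x y : Fin (n + 1) → ℕ} (h : CubePrec x y) {j : Fin (n + 1)}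
    (hj : x j = y j) : CubePrec (j.removeNth x) (j.removeNth y) := by
  obtain ⟨l, p, h1, h2, h3, h4⟩ := h
  have hpj : p ≠ j := by rintro rfl; omega
  obtain ⟨q, rfl⟩ := Fin.exists_succAbove_eq hpj
  refine ⟨l, q, fun l' hl' => ?_, ?_, h3, h4⟩
  · ext i
    exact Set.ext_iff.mp (h1 l' hl') (j.succAbove i)
  · ext i
    have := Set.ext_iff.mp h2 (j.succAbove i)
    simpa [Fin.removeNth] using this

theorem insertNth_mem_box {n k a b : ℕ} {j : Fin (n + 1)} {z : Fin n → ℕ} (hz : z ∈ box n k j)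
    (hjb : (j : ℕ) ≤ b) (hb : b ≤ j + 1) (ha : a < if (j : ℕ) < b then k + 1 else k) :
    j.insertNth (α := fun _ => ℕ) a z ∈ box (n + 1) k b := by
  rw [mem_box] at hz ⊢
  intro i
  rcases eq_or_ne i j with rfl | hi
  · simpa using ha
  · obtain ⟨q, rfl⟩ := Fin.exists_succAbove_eq hi
    have h1 : ((j.succAbove q : Fin (n + 1)) : ℕ) < b ↔ (q : ℕ) < j := by
      rw [Fin.succAbove]; split_ifs with h <;> simp [Fin.lt_def] at h ⊢ <;> omega
    simpa [h1] using hz q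

theorem isCubeLower_boxExtend {n k : ℕ} {j : Fin (n + 1)} {E : Finset (Fin n → ℕ)}
    (hE : IsCubeLower E) (hsub : E ⊆ box n k j) : IsCubeLower (boxExtend n k j E) := by
  intro x y hxy hy
  rw [mem_boxExtend] at hy ⊢
  rcases hy with hy | ⟨hyj, hyE⟩
  · exact Or.inl (isCubeLower_box _ _ _ x y hxy hy)
  have hy' : y ∈ box (n + 1) k (j + 1) := by
    have := insertNth_mem_box (a := k) (b := j + 1) (hsub hyE) (by omega) le_rfl (by simp)
    rwa [show j.insertNth (α := fun _ => ℕ) k (j.removeNth y) = y by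
      rw [← hyj]; exact Fin.insertNth_self_removeNth j y] at this
  have hx := mem_box.mp (isCubeLower_box _ _ _ x y hxy hy')
  rcases (Nat.lt_succ_iff.mp (by simpa using hx j)).lt_or_eq with h | h
  · refine Or.inl (mem_box.mpr fun i => ?_)
    rcases eq_or_ne i j with rfl | hi
    · simpa using h
    · have h1 : (i : ℕ) < j + 1 ↔ (i : ℕ) < j := by
        have : (i : ℕ) ≠ j := fun e => hi (Fin.ext e)
        omega
      simpa only [h1] using hx i
  · exact Or.inr ⟨h, hE _ _ (hxy.removeNth (h.trans hyj.symm)) hyE⟩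

theorem projSum_coe {n : ℕ} {α : Type*} [Zero α] [DecidableEq α] (A : Finset (Fin n → α)) :
    projSum (A : Set (Fin n → α)) = ∑ i, (A.image (coordProj i)).card := by
  simp only [projSum, ← Finset.coe_image, Set.ncard_coe_finset]

theorem coordProj_self_insertNth {n : ℕ} {α : Type*} [Zero α] (j : Fin (n + 1)) (a : α)
    (z : Fin n → α) : coordProj j (j.insertNth (α := fun _ => α) a z)
      = j.insertNth (α := fun _ => α) 0 z := by
  simp [coordProj]

theorem coordProj_succAbove_insertNth {n : ℕ} {α : Type*} [Zero α] (j : Fin (n + 1)) (p : Fin n)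
    (a : α) (z : Fin n → α) : coordProj (j.succAbove p) (j.insertNth (α := fun _ => α) a z)
      = j.insertNth (α := fun _ => α) a (coordProj p z) := by
  funext i
  rcases eq_or_ne i j with rfl | hi
  · simp [coordProj]
  · obtain ⟨q, rfl⟩ := Fin.exists_succAbove_eq hi
    simp [coordProj, Function.update_apply]

/-- The new points of `boxExtend n k j E` do not enlarge the projection along coordinate `j`, and
they project to new points along the other coordinates. -/
theorem projSum_boxExtend {n k : ℕ} (hk : 1 ≤ k) {j : Fin (n + 1)} {E : Finset (Fin n → ℕ)}
    (hsub : E ⊆ box n k j) :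
    projSum (boxExtend n k j E : Set (Fin (n + 1) → ℕ)) =
      projSum (box (n + 1) k j : Set (Fin (n + 1) → ℕ)) + projSum (E : Set (Fin n → ℕ)) := by
  rw [projSum_coe, projSum_coe, projSum_coe, Fin.sum_univ_succAbove _ j,
    Fin.sum_univ_succAbove _ j, add_assoc, ← Finset.sum_add_distrib]
  congr 1
  · congr 1
    refine subset_antisymm ?_ (Finset.image_subset_image Finset.subset_union_left)
    intro w hw
    obtain ⟨x, hx, rfl⟩ := Finset.mem_image.mp hw
    rcases Finset.mem_union.mp hx with hx | hx
    · exact Finset.mem_image_of_mem _ hx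
    · obtain ⟨z, hz, rfl⟩ := Finset.mem_image.mp hx
      refine Finset.mem_image.mpr ⟨j.insertNth (α := fun _ => ℕ) 0 z, ?_, ?_⟩
      · exact insertNth_mem_box (hsub hz) le_rfl (by omega) (by simp; omega)
      · rw [coordProj_self_insertNth, coordProj_self_insertNth]
  · refine Finset.sum_congr rfl fun p _ => ?_
    have hinj : Function.Injective (j.insertNth (α := fun _ => ℕ) k) :=
      Fin.insertNth_right_injective (α := fun _ => ℕ) (p := j) k
    have himg : (E.image (j.insertNth (α := fun _ => ℕ) k)).image (coordProj (j.succAbove p)) =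
        (E.image (coordProj p)).image (j.insertNth (α := fun _ => ℕ) k) := by
      simp only [Finset.image_image]
      exact Finset.image_congr fun z _ => coordProj_succAbove_insertNth j p k z
    rw [boxExtend, Finset.image_union, himg, Finset.card_union_of_disjoint,
      Finset.card_image_of_injective _ hinj]
    refine Finset.disjoint_left.mpr fun w hw hw' => ?_
    obtain ⟨x, hx, rfl⟩ := Finset.mem_image.mp hw
    obtain ⟨z, -, hz⟩ := Finset.mem_image.mp hw'
    have h1 := congrFun hz j
    have h2 := mem_box.mp hx j
    simp only [Fin.insertNth_apply_same, coordProj,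
      Function.update_of_ne (Fin.succAbove_ne j p).symm] at h1
    simp at h2
    omega

theorem boxSize_succ {n k j : ℕ} (hj : j ≤ n) :
    boxSize (n + 1) k (j + 1) = boxSize (n + 1) k j + boxSize n k j := by
  rw [boxSize, boxSize, boxSize, show n + 1 - (j + 1) = n - j by omega,
    show n + 1 - j = (n - j) + 1 by omega]
  ring

theorem boxSize_last (n k : ℕ) : boxSize n k n = boxSize n (k + 1) 0 := by
  simp [boxSize]

theorem boxSize_pos {n k j : ℕ} (hk : 1 ≤ k) : 1 ≤ boxSize n k j :=
  Nat.mul_pos (by positivity) (Nat.pow_pos hk)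

/-- Every `m ≥ 1` is a box size plus a proper part of the face that is added to that box next. -/
theorem exists_eq_boxSize_add (n : ℕ) {m : ℕ} (hm : 1 ≤ m) :
    ∃ k j r, 1 ≤ k ∧ j ≤ n ∧ r < boxSize n k j ∧ m = boxSize (n + 1) k j + r := by
  induction m, hm using Nat.le_induction with
  | base => exact ⟨1, 0, 0, le_rfl, Nat.zero_le _, boxSize_pos le_rfl, by simp [boxSize]⟩
  | succ m hm ih =>
    obtain ⟨k, j, r, hk, hj, hr, rfl⟩ := ih
    by_cases h : r + 1 < boxSize n k j
    · exact ⟨k, j, r + 1, hk, hj, h, rfl⟩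
    have e : boxSize (n + 1) k j + r + 1 = boxSize (n + 1) k (j + 1) := by
      rw [boxSize_succ hj]; omega
    rcases hj.lt_or_eq with hj' | rfl
    · exact ⟨k, j + 1, 0, hk, hj', boxSize_pos hk, by simp [e]⟩
    · exact ⟨k + 1, 0, 0, by omega, Nat.zero_le _, boxSize_pos (by omega),
        by rw [e, boxSize_last]; rfl⟩

theorem initialSegment_mono (n : ℕ) {a b : ℕ} (h : a ≤ b) :
    initialSegment n a ⊆ initialSegment n b :=
  fun _ hx => lt_of_lt_of_le (show _ < (a : ℕ∞) from hx) (by exact_mod_cast h)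

theorem IsCubeLower.subset_box {n k j : ℕ} {E : Finset (Fin n → ℕ)} (hE : IsCubeLower E)
    (hj : j ≤ n) (hc : E.card ≤ boxSize n k j) : E ⊆ box n k j := by
  rw [← card_box hj] at hc
  have := initialSegment_mono n hc
  rwa [initialSegment_card hE, initialSegment_card (isCubeLower_box n k j),
    Finset.coe_subset] at this

theorem isCubeLower_empty (n : ℕ) : IsCubeLower (∅ : Finset (Fin n → ℕ)) :=
  fun _ _ _ h => absurd h (Finset.notMem_empty _)

/-- Initial segments of every length exist, except that `ℕ^0` is a single point. -/
theorem exists_isCubeLower (n m : ℕ) (h : 1 ≤ n ∨ m ≤ 1) :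
    ∃ D : Finset (Fin n → ℕ), IsCubeLower D ∧ D.card = m := by
  induction n generalizing m with
  | zero =>
    rcases Nat.le_one_iff_eq_zero_or_eq_one.mp (h.resolve_left (by omega)) with rfl | rfl
    · exact ⟨∅, isCubeLower_empty 0, rfl⟩
    · exact ⟨Finset.univ, fun _ _ _ _ => Finset.mem_univ _, by simp⟩
  | succ n ih =>
    rcases Nat.eq_zero_or_pos m with rfl | hm
    · exact ⟨∅, isCubeLower_empty _, rfl⟩
    obtain ⟨k, j, r, hk, hj, hr, rfl⟩ := exists_eq_boxSize_add n hm
    have hr' : 1 ≤ n ∨ r ≤ 1 := by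
      rcases Nat.eq_zero_or_pos n with rfl | hn
      · obtain rfl : j = 0 := by omega
        simp [boxSize] at hr
        omega
      · exact Or.inl hn
    obtain ⟨E, hE, rfl⟩ := ih r hr'
    exact ⟨boxExtend n k ⟨j, by omega⟩ E,
      isCubeLower_boxExtend hE (hE.subset_box hj hr.le), card_boxExtend⟩

/-- The recursion for the projection sums: while a new face is being filled in cube order, the
projection sum grows as it does for initial segments one dimension below. -/
theorem sigma_boxSize_add {n k j r : ℕ} (hk : 1 ≤ k) (hj : j ≤ n) (hr : r ≤ boxSize n k j) :
    sigma (n + 1) (boxSize (n + 1) k j + r) = sigma (n + 1) (boxSize (n + 1) k j) + sigma n r := by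
  have hr' : 1 ≤ n ∨ r ≤ 1 := by
    rcases Nat.eq_zero_or_pos n with rfl | hn
    · obtain rfl : j = 0 := by omega
      simp [boxSize] at hr
      omega
    · exact Or.inl hn
  obtain ⟨E, hE, rfl⟩ := exists_isCubeLower n r hr'
  have hsub := hE.subset_box hj hr
  have h1 := initialSegment_card
    (isCubeLower_boxExtend (j := ⟨j, Nat.lt_succ_of_le hj⟩) hE hsub)
  have h2 := initialSegment_card (isCubeLower_box (n + 1) k j)
  rw [card_boxExtend] at h1
  rw [card_box (by omega)] at h2
  rw [sigma, sigma, sigma, h2, initialSegment_card hE, h1]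
  exact projSum_boxExtend hk hsub

theorem sigma_zero_left (m : ℕ) : sigma 0 m = 0 := by
  simp [sigma, projSum]

theorem sigma_zero_right (n : ℕ) : sigma n 0 = 0 := by
  have h := initialSegment_card (isCubeLower_empty n)
  rw [Finset.card_empty] at h
  simp [sigma, h, projSum]

theorem sigma_one (n : ℕ) : sigma n 1 = n := by
  have h := initialSegment_card (isCubeLower_box n 1 0)
  rw [card_box (Nat.zero_le _), boxSize] at h
  simp only [pow_zero, one_pow, mul_one] at h
  have hb : ∃ x, box n 1 0 = {x} := by
    rw [← Finset.card_eq_one, card_box (Nat.zero_le _)]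
    simp [boxSize]
  obtain ⟨x, hx⟩ := hb
  simp [sigma, h, hx, projSum]

/-! ### Inequalities between the numbers `sigma n m` -/

theorem boxSize_mono {n k k' j j' : ℕ} (hj : j ≤ n) (hj' : j' ≤ n)
    (h : k < k' ∨ k = k' ∧ j ≤ j') : boxSize n k j ≤ boxSize n k' j' := by
  rcases h with h | ⟨rfl, h⟩
  · calc boxSize n k j ≤ (k + 1) ^ j * (k + 1) ^ (n - j) :=
          Nat.mul_le_mul_left _ (Nat.pow_le_pow_left (by omega) _)
      _ = (k + 1) ^ n := by rw [← pow_add]; congr 1; omega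
      _ ≤ k' ^ n := Nat.pow_le_pow_left h _
      _ = k' ^ j' * k' ^ (n - j') := by rw [← pow_add]; congr 1; omega
      _ ≤ boxSize n k' j' := Nat.mul_le_mul_right _ (Nat.pow_le_pow_left (by omega) _)
  · rw [boxSize, boxSize, show n - j = (n - j') + (j' - j) by omega, pow_add,
      show (k + 1) ^ j' = (k + 1) ^ j * (k + 1) ^ (j' - j) by rw [← pow_add]; congr 1; omega]
    calc (k + 1) ^ j * (k ^ (n - j') * k ^ (j' - j))
        ≤ (k + 1) ^ j * (k ^ (n - j') * (k + 1) ^ (j' - j)) := by gcongr; omega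
      _ = _ := by ring

theorem pow_le_boxSize {n k j : ℕ} (hj : j ≤ n) : k ^ n ≤ boxSize n k j := by
  simpa [boxSize] using boxSize_mono (k := k) (Nat.zero_le n) hj (Or.inr ⟨rfl, Nat.zero_le _⟩)

theorem boxSize_le_pow {n k j : ℕ} (hj : j ≤ n) : boxSize n k j ≤ (k + 1) ^ n := by
  simpa [boxSize] using boxSize_mono (k := k) hj le_rfl (Or.inr ⟨rfl, hj⟩)

/-- As `exists_eq_boxSize_add`, but with a nonempty and possibly complete part of the new face. -/
theorem exists_eq_boxSize_add_pos (n : ℕ) {m : ℕ} (hm : 2 ≤ m) :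
    ∃ k j r, 1 ≤ k ∧ j ≤ n ∧ 1 ≤ r ∧ r ≤ boxSize n k j ∧ m = boxSize (n + 1) k j + r := by
  obtain ⟨k, j, r, hk, hj, hr, h⟩ := exists_eq_boxSize_add n (m := m - 1) (by omega)
  exact ⟨k, j, r + 1, hk, hj, by omega, hr, by omega⟩

theorem sigma_boxSize_succ {n k j : ℕ} (hk : 1 ≤ k) (hj : j ≤ n) :
    sigma (n + 1) (boxSize (n + 1) k (j + 1)) =
      sigma (n + 1) (boxSize (n + 1) k j) + sigma n (boxSize n k j) := by
  rw [boxSize_succ hj, sigma_boxSize_add hk hj le_rfl]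

/-- Subadditivity of `sigma n`. -/
def SigmaSubadditive (n : ℕ) : Prop :=
  ∀ a b, sigma n (a + b) ≤ sigma n a + sigma n b

/-- Among all windows of `c` consecutive points of a box, in cube order, the last one contributes
least to the projection sum. -/
def SigmaFinalWindow (n : ℕ) : Prop :=
  ∀ c k j r, 1 ≤ k → j ≤ n → r + c ≤ boxSize n k j →
    sigma n (boxSize n k j) + sigma n r ≤ sigma n (boxSize n k j - c) + sigma n (r + c)

/-- The numerical form of slicing: if a set of `m ≤ (k + 1) ^ (n + 1)` points in dimension `n + 1`
loses its smallest slice, of `b` points, along a direction with at least `k + 1` slices, then lower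
bounds by `sigma` for the slice and for the rest give the lower bound for the set. -/
def SigmaSlice (n : ℕ) : Prop :=
  ∀ k m b, 1 ≤ k → m ≤ (k + 1) ^ (n + 1) → b * (k + 1) ≤ m →
    sigma (n + 1) m ≤ sigma (n + 1) (m - b) + sigma n b

/-- Strong induction on the length of the window. Long windows are cut at the length of the last
face; short ones are compared, face by face, with windows one dimension below. -/
theorem sigmaFinalWindow_succ {n : ℕ} (hQ : SigmaFinalWindow n) (hS : SigmaSubadditive n) :
    SigmaFinalWindow (n + 1) := by
  intro c
  induction c using Nat.strong_induction_on with
  | _ c ih =>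
  -- A box with at least one long side has a last face; only the unit cube has none.
  have main : ∀ k j r, 1 ≤ k → j ≤ n → r + c ≤ boxSize (n + 1) k (j + 1) →
      sigma (n + 1) (boxSize (n + 1) k (j + 1)) + sigma (n + 1) r ≤
        sigma (n + 1) (boxSize (n + 1) k (j + 1) - c) + sigma (n + 1) (r + c) := by
    intro k j r hk hj hrc
    rcases Nat.eq_zero_or_pos c with rfl | hc
    · simp
    have hF := boxSize_pos (n := n) (j := j) hk
    have hBsucc := boxSize_succ (k := k) hj
    have hsucc := sigma_boxSize_succ (k := k) hk hj
    rcases lt_or_ge (boxSize n k j) c with hcF | hcF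
    · -- Long windows: the final `boxSize n k j` points and the others are treated separately.
      have h1 := ih (boxSize n k j) hcF k (j + 1) (r + c - boxSize n k j) hk (by omega) (by omega)
      have h2 := ih (c - boxSize n k j) (by omega) k j r hk (by omega) (by omega)
      rw [show boxSize (n + 1) k (j + 1) - boxSize n k j = boxSize (n + 1) k j by omega,
        show r + c - boxSize n k j + boxSize n k j = r + c by omega] at h1
      rw [show boxSize (n + 1) k j - (c - boxSize n k j) = boxSize (n + 1) k (j + 1) - c by omega,
        show r + (c - boxSize n k j) = r + c - boxSize n k j by omega] at h2
      omega
    · -- Short windows: the final one lies inside the last face.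
      have tail : ∀ e, e ≤ boxSize n k j →
          sigma (n + 1) (boxSize (n + 1) k (j + 1) - e) + sigma n (boxSize n k j) =
            sigma (n + 1) (boxSize (n + 1) k (j + 1)) + sigma n (boxSize n k j - e) := by
        intro e he
        rw [show boxSize (n + 1) k (j + 1) - e = boxSize (n + 1) k j + (boxSize n k j - e) by omega,
          sigma_boxSize_add hk hj (Nat.sub_le _ _), hsucc]
        ring
      have htc := tail c hcF
      rcases Nat.lt_or_ge (r + c) 2 with h1 | h2
      · obtain rfl : c = 1 := by omega
        obtain rfl : r = 0 := by omega
        have hs := hS (boxSize n k j - 1) 1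
        rw [Nat.sub_add_cancel hF, sigma_one] at hs
        rw [zero_add, sigma_one, sigma_zero_right]
        omega
      obtain ⟨k', j', r', hk', hj', hr'0, hr', he⟩ := exists_eq_boxSize_add_pos n h2
      have hfaces : boxSize n k' j' ≤ boxSize n k j := by
        refine boxSize_mono hj' hj ?_
        by_contra hcon
        have : boxSize (n + 1) k (j + 1) ≤ boxSize (n + 1) k' j' :=
          boxSize_mono (by omega) (by omega) (by omega)
        omega
      rw [he, sigma_boxSize_add hk' hj' hr']
      rcases le_or_gt c r' with hcr | hcr
      · -- The window lies inside one face.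
        have hr0 : r = boxSize (n + 1) k' j' + (r' - c) := by omega
        have hq := hQ c k j (r' - c) hk hj (by omega)
        rw [Nat.sub_add_cancel hcr] at hq
        rw [hr0, sigma_boxSize_add hk' hj' (by omega)]
        omega
      · -- The window meets the last face it reaches in an initial part of length `r'`.
        have hi := ih (c - r') (by omega) k (j + 1) r hk (by omega) (by omega)
        rw [show r + (c - r') = boxSize (n + 1) k' j' by omega] at hi
        have ht := tail (c - r') (by omega)
        have hs := hS (boxSize n k j - c) r'
        rw [show boxSize n k j - c + r' = boxSize n k j - (c - r') by omega] at hs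
        omega
  intro k j r hk hj hrc
  rcases Nat.eq_zero_or_pos j with rfl | hj0
  · rcases hk.eq_or_lt with rfl | hk1
    · have hb : boxSize (n + 1) 1 0 = 1 := by simp [boxSize]
      rw [hb] at hrc ⊢
      obtain rfl | ⟨rfl, rfl⟩ : c = 0 ∨ (c = 1 ∧ r = 0) := by omega
      · simp
      · simp [add_comm]
    · obtain ⟨k, rfl⟩ : ∃ k', k = k' + 1 := ⟨k - 1, by omega⟩
      rw [← boxSize_last] at hrc ⊢
      exact main k n r (by omega) le_rfl hrc
  · obtain ⟨j, rfl⟩ : ∃ j', j = j' + 1 := ⟨j - 1, by omega⟩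
    exact main k j r hk (by omega) hrc

/-- Write `m` as a box plus `r` points of the next face. A slice with `b ≤ r` is taken from
that face. A larger one is also taken from the last face of the box, and the final-window
inequality for that face applies, unless the slice is even larger than the face, in which case the
statement reduces to itself one dimension below. -/
theorem sigmaSlice_of {n : ℕ} (hQ : SigmaFinalWindow n) (hS : SigmaSubadditive n)
    (hP : ∀ n', n = n' + 1 → SigmaSlice n') : SigmaSlice n := by
  intro k₀ m b hk₀ hm hb
  rcases Nat.eq_zero_or_pos b with rfl | hb0
  · simp
  have hm2 : 2 ≤ m := by nlinarith
  obtain ⟨k, j, r, hk, hj, hr0, hr, rfl⟩ := exists_eq_boxSize_add_pos n hm2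
  have hkk : k ≤ k₀ := by
    have h1 := pow_le_boxSize (n := n + 1) (k := k) (j := j) (by omega)
    have h2 : k ^ (n + 1) < (k₀ + 1) ^ (n + 1) := by omega
    exact Nat.lt_succ_iff.mp (lt_of_pow_lt_pow_left₀ _ (by omega) h2)
  -- Only the bound for the true side length `k` matters from here on.
  replace hb : b * (k + 1) ≤ boxSize (n + 1) k j + r :=
    (Nat.mul_le_mul_left b (by omega)).trans hb
  rw [sigma_boxSize_add hk hj hr]
  rcases le_or_gt b r with hbr | hbr
  · have hs := hS (r - b) b
    rw [Nat.sub_add_cancel hbr] at hs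
    rw [Nat.add_sub_assoc hbr, sigma_boxSize_add hk hj (by omega)]
    omega
  rcases Nat.eq_zero_or_pos j with rfl | hj0
  · rcases hk.eq_or_lt with rfl | hk1
    · simp [boxSize] at hr hb
      omega
    · -- The last face of the cube of side `k` is a cube of side `k`.
      obtain ⟨k, rfl⟩ : ∃ k', k = k' + 1 := ⟨k - 1, by omega⟩
      have hk' : 1 ≤ k := by omega
      have hsucc := sigma_boxSize_succ (j := n) hk' le_rfl
      have hBsucc := boxSize_succ (n := n) (k := k) le_rfl
      rw [boxSize_last, boxSize_last n] at hBsucc hsucc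
      have hbF : b ≤ boxSize n (k + 1) 0 := by
        have : boxSize (n + 1) (k + 1) 0 = boxSize n (k + 1) 0 * (k + 1) := by
          simp [boxSize, pow_succ]
        by_contra hcon
        nlinarith
      have hq := hQ (b - r) (k + 1) 0 r (by omega) (by omega) (by omega)
      rw [show r + (b - r) = b by omega] at hq
      rw [show boxSize (n + 1) (k + 1) 0 + r - b
          = boxSize (n + 1) k n + (boxSize n (k + 1) 0 - (b - r)) by omega,
        sigma_boxSize_add hk' le_rfl (by rw [boxSize_last]; omega)]
      omega
  · obtain ⟨j, rfl⟩ : ∃ j', j = j' + 1 := ⟨j - 1, by omega⟩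
    have hj' : j ≤ n := by omega
    have hsucc := sigma_boxSize_succ hk hj'
    have hBsucc := boxSize_succ (k := k) hj'
    rcases le_or_gt b (boxSize n k j) with hbF | hbF
    · have hq := hQ (b - r) k j r hk hj' (by omega)
      rw [show r + (b - r) = b by omega] at hq
      rw [show boxSize (n + 1) k (j + 1) + r - b
          = boxSize (n + 1) k j + (boxSize n k j - (b - r)) by omega,
        sigma_boxSize_add hk hj' (by omega)]
      omega
    · -- The slice exceeds the last face by `u`; both parts drop one dimension.
      obtain ⟨n, rfl⟩ : ∃ n', n = n' + 1 := ⟨n - 1, by omega⟩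
      obtain ⟨u, rfl⟩ : ∃ u, b = boxSize (n + 1) k j + u := ⟨b - boxSize (n + 1) k j, by omega⟩
      have hprod : boxSize (n + 1 + 1) k (j + 1) = boxSize (n + 1) k j * (k + 1) := by
        rw [boxSize, boxSize, show n + 1 + 1 - (j + 1) = n + 1 - j by omega]
        ring
      have hu : u * (k + 1) ≤ r := by nlinarith
      have hprod' : boxSize (n + 1) k (j + 1) = boxSize n k j * (k + 1) := by
        rw [boxSize, boxSize, show n + 1 - (j + 1) = n - j by omega]
        ring
      have hur : u ≤ r := (Nat.le_mul_of_pos_right u (by omega)).trans hu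
      have hu' : u ≤ boxSize n k j := by
        refine Nat.le_of_mul_le_mul_right (c := k + 1) ?_ (by omega)
        omega
      have hp := hP n rfl k r u hk (hr.trans (boxSize_le_pow (by omega))) hu
      rw [show boxSize (n + 1 + 1) k (j + 1) + r - (boxSize (n + 1) k j + u)
          = boxSize (n + 1 + 1) k j + (r - u) by omega,
        sigma_boxSize_add hk hj' (by omega), sigma_boxSize_add hk (by omega) hu']
      omega

/-- Induction on the smaller summand: its last face is small enough, compared with the whole sum,
to be removed as a slice. -/
theorem sigmaSubadditive_succ {n : ℕ} (hP : SigmaSlice n) : SigmaSubadditive (n + 1) := by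
  have main : ∀ a b, a ≤ b → sigma (n + 1) (a + b) ≤ sigma (n + 1) a + sigma (n + 1) b := by
    intro a
    induction a using Nat.strong_induction_on with
    | _ a ih =>
    intro b hab
    rcases Nat.eq_zero_or_pos a with rfl | ha
    · simp
    obtain ⟨k, j, r, hk, hj, hr0, hr, he⟩ := exists_eq_boxSize_add_pos n (m := a + b) (by omega)
    have hklow : k ^ (n + 1) < a + b := by
      have := pow_le_boxSize (n := n + 1) (k := k) (j := j) (by omega)
      omega
    have hkup : a + b ≤ (k + 1) ^ (n + 1) := by
      have := boxSize_le_pow (n := n + 1) (k := k) (j := j + 1) (by omega)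
      rw [boxSize_succ hj] at this
      omega
    rcases Nat.eq_or_lt_of_le ha with h1 | h2
    · obtain rfl : 1 = a := h1
      have hp := hP k (1 + b) 1 hk hkup (by
        have := Nat.le_self_pow (n := n + 1) (by omega) k
        omega)
      rw [Nat.add_sub_cancel_left, sigma_one] at hp
      rw [sigma_one]
      omega
    · -- Peel off the last face, or part of a face, of the initial segment of length `a`.
      obtain ⟨t, i, a', ht, hi, ha0, haF, rfl⟩ := exists_eq_boxSize_add_pos n h2
      have hBpos := boxSize_pos (n := n + 1) (j := i) ht
      have hi' := ih (boxSize (n + 1) t i) (by omega) b (by omega)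
      have hprod : boxSize (n + 1) t i = boxSize n t i * t := by
        rw [boxSize, boxSize, show n + 1 - i = n - i + 1 by omega]
        ring
      have ha' : a' * (t + 1) ≤ boxSize (n + 1) t i + a' := by nlinarith
      have hslice : a' * (k + 1) ≤ boxSize (n + 1) t i + a' + b := by
        rcases le_or_gt (k + 1) (2 * (t + 1)) with hkt | hkt
        · calc a' * (k + 1) ≤ a' * (2 * (t + 1)) := Nat.mul_le_mul_left _ hkt
            _ = 2 * (a' * (t + 1)) := by ring
            _ ≤ _ := by omega
        · refine le_trans ?_ (Nat.succ_le_of_lt hklow)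
          have haF' : a' ≤ (t + 1) ^ n := haF.trans (boxSize_le_pow hi)
          rcases n with _ | n
          · have : a' ≤ 1 := by simpa using haF'
            simp
            nlinarith
          · have h3 : (t + 1) ^ n ≤ k ^ n := Nat.pow_le_pow_left (by omega) n
            have h4 : 2 * a' ≤ k ^ n * k := by
              calc 2 * a' ≤ (t + 1) ^ n * (2 * (t + 1)) := by rw [pow_succ] at haF'; linarith
                _ ≤ k ^ n * k := Nat.mul_le_mul h3 (by omega)
            rw [pow_succ, pow_succ]
            nlinarith
      have hp := hP k _ a' hk hkup hslice
      rw [show boxSize (n + 1) t i + a' + b - a' = boxSize (n + 1) t i + b by omega] at hp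
      rw [sigma_boxSize_add ht hi haF]
      omega
  intro a b
  rcases le_total a b with h | h
  · exact main a b h
  · have := main b a h
    rwa [add_comm b a, add_comm (sigma _ b)] at this

theorem sigma_inequalities (n : ℕ) :
    SigmaSubadditive n ∧ SigmaFinalWindow n ∧ SigmaSlice n := by
  induction n with
  | zero =>
    have hS : SigmaSubadditive 0 := fun a b => by simp [sigma_zero_left]
    have hQ : SigmaFinalWindow 0 := fun c k j r _ _ _ => by simp [sigma_zero_left]
    exact ⟨hS, hQ, sigmaSlice_of hQ hS fun _ h => by omega⟩
  | succ n ih =>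
    obtain ⟨hS, hQ, hP⟩ := ih
    have hS' := sigmaSubadditive_succ hP
    have hQ' := sigmaFinalWindow_succ hQ hS
    refine ⟨hS', hQ', sigmaSlice_of hQ' hS' fun n' h => ?_⟩
    obtain rfl : n = n' := by omega
    exact hP

/-! ### The projection inequality for finite sets -/

/-- Deleting the points with `x i = a` from `A` lowers the projection count along another
coordinate by the projection count of the deleted slice. -/
theorem card_image_coordProj_slice {n : ℕ} {α : Type*} [Zero α] [DecidableEq α]
    (A : Finset (Fin n → α)) {i i' : Fin n} (h : i' ≠ i) (a : α) :
    (A.image (coordProj i')).card =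
      ((A.filter fun x => x i ≠ a).image (coordProj i')).card +
        ((A.filter fun x => x i = a).image (coordProj i')).card := by
  rw [← Finset.card_union_of_disjoint, ← Finset.image_union]
  · congr 2
    ext x
    simp only [Finset.mem_union, Finset.mem_filter]
    tauto
  · refine Finset.disjoint_left.mpr fun w hw hw' => ?_
    obtain ⟨x, hx, rfl⟩ := Finset.mem_image.mp hw
    obtain ⟨y, hy, hxy⟩ := Finset.mem_image.mp hw'
    have := congrFun hxy i
    simp only [coordProj, Function.update_of_ne h.symm] at this
    exact (Finset.mem_filter.mp hx).2 (this ▸ (Finset.mem_filter.mp hy).2)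

/-- A set of more than `k ^ |S|` points whose coordinates outside `S` are constant takes more than
`k` values in some coordinate from `S`. -/
theorem exists_lt_card_image_apply {ι α : Type*} [Fintype ι] [DecidableEq ι] [DecidableEq α]
    {A : Finset (ι → α)} {S : Finset ι} (hA : ∀ x ∈ A, ∀ y ∈ A, ∀ i ∉ S, x i = y i) {k : ℕ}
    (hk : k ^ S.card < A.card) : ∃ i ∈ S, k < (A.image fun x => x i).card := by
  by_contra! hcon
  refine absurd hk (not_lt.mpr ?_)
  calc A.card ≤ (Fintype.piFinset fun i => A.image fun x => x i).card :=
        Finset.card_le_card fun x hx => Fintype.mem_piFinset.mpr fun i =>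
          Finset.mem_image_of_mem _ hx
    _ = ∏ i, (A.image fun x => x i).card := Fintype.card_piFinset _
    _ ≤ ∏ i, if i ∈ S then k else 1 := by
        refine Finset.prod_le_prod' fun i _ => ?_
        split_ifs with hi
        · exact hcon i hi
        · refine Finset.card_le_one.mpr fun a ha b hb => ?_
          obtain ⟨x, hx, rfl⟩ := Finset.mem_image.mp ha
          obtain ⟨y, hy, rfl⟩ := Finset.mem_image.mp hb
          exact hA x hx y hy i hi
    _ = k ^ S.card := by simp

/-- The projection inequality, for sets whose coordinates outside `S` are constant. This form
lets the dimension drop to that of a slice without changing the ambient space. -/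
theorem sigma_card_le_sum_coordProj {n : ℕ} {α : Type*} [Zero α] [DecidableEq α]
    (A : Finset (Fin n → α)) (S : Finset (Fin n))
    (hA : ∀ x ∈ A, ∀ y ∈ A, ∀ i ∉ S, x i = y i) :
    sigma S.card A.card ≤ ∑ i ∈ S, (A.image (coordProj i)).card := by
  induction hm : A.card using Nat.strong_induction_on generalizing A S with
  | _ m ih =>
  subst hm
  rcases Nat.lt_or_ge A.card 2 with h2 | h2
  · obtain h | h : A.card = 0 ∨ A.card = 1 := by omega
    · simp [h, sigma_zero_right]
    · rw [h, sigma_one]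
      obtain ⟨x, rfl⟩ := Finset.card_eq_one.mp h
      simp
  obtain ⟨d, hd⟩ : ∃ d, S.card = d + 1 := by
    refine Nat.exists_eq_succ_of_ne_zero fun h0 => ?_
    obtain rfl := Finset.card_eq_zero.mp h0
    have : A.card ≤ 1 := Finset.card_le_one.mpr fun x hx y hy =>
      funext fun i => hA x hx y hy i (Finset.notMem_empty i)
    omega
  obtain ⟨k, j, r, hk, hj, hr0, hr, he⟩ := exists_eq_boxSize_add_pos d h2
  have hklow : k ^ S.card < A.card := by
    have := pow_le_boxSize (n := d + 1) (k := k) (j := j) (by omega)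
    rw [hd]; omega
  have hkup : A.card ≤ (k + 1) ^ (d + 1) := by
    have := boxSize_le_pow (n := d + 1) (k := k) (j := j + 1) (by omega)
    rw [boxSize_succ hj] at this
    omega
  obtain ⟨i, hiS, hi⟩ := exists_lt_card_image_apply hA hklow
  -- The smallest of at least `k + 1` slices.
  obtain ⟨a, ha, hmin⟩ := Finset.exists_min_image (A.image fun x : Fin n → α => x i)
    (fun a => (A.filter fun x : Fin n → α => x i = a).card) (Finset.card_pos.mp (by omega))
  set b := (A.filter fun x => x i = a).card with hb
  have hbk : b * (k + 1) ≤ A.card := by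
    rw [Finset.card_eq_sum_card_image (fun x => x i) A]
    calc b * (k + 1) ≤ (A.image fun x => x i).card * b := by
          rw [mul_comm]; exact Nat.mul_le_mul_right _ hi
      _ ≤ _ := by
          rw [← smul_eq_mul]
          exact Finset.card_nsmul_le_sum _ _ _ hmin
  have hb0 : 0 < b := by
    obtain ⟨x, hx, rfl⟩ := Finset.mem_image.mp ha
    exact Finset.card_pos.mpr ⟨x, Finset.mem_filter.mpr ⟨hx, rfl⟩⟩
  have hsplit : (A.filter fun x => x i ≠ a).card = A.card - b := by
    have := Finset.card_filter_add_card_filter_not (s := A) (fun x => x i = a)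
    simp only [ne_eq]
    omega
  have hb1 : b < A.card := by nlinarith
  have h1 := ih (A.card - b) (by omega) (A.filter fun x => x i ≠ a) S
    (fun x hx y hy => hA x (Finset.mem_of_mem_filter x hx) y (Finset.mem_of_mem_filter y hy)) hsplit
  have h3 := ih b hb1 (A.filter fun x => x i = a) (S.erase i) (by
    intro x hx y hy i' hi'
    rw [Finset.mem_filter] at hx hy
    rcases eq_or_ne i' i with rfl | hne
    · rw [hx.2, hy.2]
    · exact hA x hx.1 y hy.1 i' fun h => hi' (Finset.mem_erase.mpr ⟨hne, h⟩)) rfl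
  rw [Finset.card_erase_of_mem hiS, hd, Nat.add_sub_cancel] at h3
  have hP := (sigma_inequalities d).2.2 k A.card b hk hkup hbk
  rw [hd] at h1 ⊢
  have hsum : ∑ i' ∈ S.erase i, (A.image (coordProj i')).card =
      ∑ i' ∈ S.erase i, ((A.filter fun x => x i ≠ a).image (coordProj i')).card +
        ∑ i' ∈ S.erase i, ((A.filter fun x => x i = a).image (coordProj i')).card := by
    rw [← Finset.sum_add_distrib]
    exact Finset.sum_congr rfl fun i' hi' =>
      card_image_coordProj_slice A (Finset.ne_of_mem_erase hi') a
  have hle : ((A.filter fun x => x i ≠ a).image (coordProj i)).card ≤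
      (A.image (coordProj i)).card :=
    Finset.card_le_card (Finset.image_subset_image (Finset.filter_subset _ _))
  rw [← Finset.add_sum_erase S _ hiS] at h1 ⊢
  omega

/-- Initial segments minimise the projection sum. -/
theorem sigma_card_le_projSum {n : ℕ} {α : Type*} [Zero α] (A : Finset (Fin n → α)) :
    sigma n A.card ≤ projSum (A : Set (Fin n → α)) := by
  classical
  have := sigma_card_le_sum_coordProj A Finset.univ fun x _ y _ i hi =>
    absurd (Finset.mem_univ i) hi
  rwa [Finset.card_univ, Fintype.card_fin, ← projSum_coe] at this

/-- The numerical inequality follows from the geometric one: stack initial segments of `ℕ^(n-1)`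
as slices of a set in `ℕ^n`. As they are nested, the projection along the stacking direction is the
largest of them. -/
theorem sigma_sum_le {n s : ℕ} (hn : 1 ≤ n) (m : Fin s → ℕ) :
    sigma n (∑ k, m k) ≤ (∑ k, sigma (n - 1) (m k)) + Finset.univ.sup m := by
  obtain ⟨n, rfl⟩ : ∃ n', n = n' + 1 := ⟨n - 1, by omega⟩
  rw [Nat.add_sub_cancel]
  rcases Nat.eq_zero_or_pos n with rfl | hn0
  · -- `ℕ^0` has too few points; in dimension one the projection is a single point.
    rcases Nat.eq_zero_or_pos (∑ k, m k) with h0 | h0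
    · rw [h0, sigma_zero_right]; exact Nat.zero_le _
    · have h1 : sigma (0 + 1) (∑ k, m k) ≤ 1 := by
        obtain ⟨B, -, hB⟩ := exists_isCubeLower 1 (∑ k, m k) (Or.inl le_rfl)
        rw [← hB]
        refine (sigma_card_le_projSum B).trans ?_
        rw [projSum_coe, Fin.sum_univ_one]
        refine Finset.card_le_one.mpr fun w hw w' hw' => ?_
        obtain ⟨x, -, rfl⟩ := Finset.mem_image.mp hw
        obtain ⟨y, -, rfl⟩ := Finset.mem_image.mp hw'
        funext p
        rw [Subsingleton.elim p 0]
        simp [coordProj]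
      obtain ⟨k, hk, hk'⟩ := Finset.exists_ne_zero_of_sum_ne_zero h0.ne'
      have := Finset.le_sup (f := m) hk
      omega
  choose D hD hDc using fun a => exists_isCubeLower n a (Or.inl hn0)
  have hDmono : ∀ a b, a ≤ b → D a ⊆ D b := fun a b h => by
    have := initialSegment_mono n h
    have ea := initialSegment_card (hD a)
    have eb := initialSegment_card (hD b)
    rw [hDc] at ea eb
    rwa [ea, eb, Finset.coe_subset] at this
  have hDs : ∀ a, sigma n a = ∑ i, ((D a).image (coordProj i)).card := fun a => by
    have ea := initialSegment_card (hD a)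
    rw [hDc] at ea
    rw [sigma, ea, projSum_coe]
  let ins : Fin s → (Fin n → ℕ) → (Fin (n + 1) → ℕ) :=
    fun k => (0 : Fin (n + 1)).insertNth (α := fun _ => ℕ) (k : ℕ)
  have hinj : ∀ k, Function.Injective (ins k) := fun k =>
    Fin.insertNth_right_injective (α := fun _ => ℕ) (p := 0) (k : ℕ)
  let A : Finset (Fin (n + 1) → ℕ) := Finset.univ.biUnion fun k => (D (m k)).image (ins k)
  have hAc : A.card = ∑ k, m k := by
    rw [Finset.card_biUnion]
    · exact Finset.sum_congr rfl fun k _ => by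
        rw [Finset.card_image_of_injective _ (hinj k), hDc]
    · intro k _ k' _ hkk
      refine Finset.disjoint_left.mpr fun w hw hw' => hkk (Fin.ext ?_)
      obtain ⟨z, -, rfl⟩ := Finset.mem_image.mp hw
      obtain ⟨z', -, h⟩ := Finset.mem_image.mp hw'
      simpa [ins] using (congrFun h 0).symm
  have h := sigma_card_le_projSum A
  rw [hAc, projSum_coe, Fin.sum_univ_succAbove _ 0] at h
  refine h.trans ?_
  rw [add_comm]
  refine Nat.add_le_add ?_ ?_
  · simp only [hDs]
    rw [Finset.sum_comm]
    refine Finset.sum_le_sum fun p _ => ?_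
    rw [Finset.biUnion_image]
    refine Finset.card_biUnion_le.trans (Finset.sum_le_sum fun k _ => ?_)
    have himg : ((D (m k)).image (ins k)).image (coordProj ((0 : Fin (n + 1)).succAbove p)) =
        ((D (m k)).image (coordProj p)).image (ins k) := by
      simp only [Finset.image_image]
      exact Finset.image_congr fun z _ => coordProj_succAbove_insertNth 0 p (k : ℕ) z
    rw [himg]
    exact Finset.card_image_le
  · rw [← hDc (Finset.univ.sup m)]
    refine le_trans (Finset.card_le_card ?_)
      (Finset.card_image_le (f := (0 : Fin (n + 1)).insertNth (α := fun _ => ℕ) 0))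
    intro w hw
    obtain ⟨x, hx, rfl⟩ := Finset.mem_image.mp hw
    obtain ⟨k, hk, hx⟩ := Finset.mem_biUnion.mp hx
    obtain ⟨z, hz, rfl⟩ := Finset.mem_image.mp hx
    exact Finset.mem_image.mpr ⟨z, hDmono _ _ (Finset.le_sup hk) hz,
      (coordProj_self_insertNth 0 (k : ℕ) z).symm⟩

theorem theorem4 :
    (∀ n s : ℕ, 1 ≤ n → 1 ≤ s → ∀ m : Fin s → ℕ,
      sigma n (∑ k, m k) ≤ (∑ k, sigma (n - 1) (m k)) + Finset.univ.sup m) ∧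
    ((∀ n s : ℕ, 1 ≤ n → 1 ≤ s → ∀ m : Fin s → ℕ,
      sigma n (∑ k, m k) ≤ (∑ k, sigma (n - 1) (m k)) + Finset.univ.sup m) ↔
    (∀ n : ℕ, 1 ≤ n → ∀ A : Set (Fin n → ℝ), A.Finite →
      sigma n A.ncard ≤ projSum A)) := by
  have h1 : ∀ n s : ℕ, 1 ≤ n → 1 ≤ s → ∀ m : Fin s → ℕ,
      sigma n (∑ k, m k) ≤ (∑ k, sigma (n - 1) (m k)) + Finset.univ.sup m :=
    fun n s hn _ m => sigma_sum_le hn m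
  refine ⟨h1, fun _ n _ A hA => ?_, fun _ => h1⟩
  lift A to Finset (Fin n → ℝ) using hA
  rw [Set.ncard_coe_finset]
  exact sigma_card_le_projSum A
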